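/- Let $\mathbb H=\{z=x+iy: y>0\}$, let $j(\gamma,z)=cz+d$ for $\gamma=\begin{pmatrix}a&b\\c&d\end{pmatrix}$, let $U=\begin{pmatrix}1&1\\0&1\end{pmatrix}$, and define complex powers $w^k=\exp(k\log w)$ by the principal branch ($-\pi<\arg w\le\pi$). Let $\Gamma$ be a finite index subgroup of $\mathrm{SL}_2(\mathbb Z)$ with $-I\in\Gamma$ and let $k$ be real. An automorphy factor of weight $k$ on $\Gamma$ is a function $\nu:\Gamma\times\mathbb H\to\mathbb C$, holomorphic in $z\in\mathbb H$, such that for all $\gamma,\tau\in\Gamma$ and $z\in\mathbb H$: $|\nu(\gamma,z)|=|j(\gamma,z)|^k$, $\nu(\tau\gamma,z)=\nu(\tau,\gamma z)\,\nu(\gamma,z)$ and $\nu(-\gamma,z)=\nu(\gamma,z)$. The quotient $\upsilon(\gamma)=\nu(\gamma,z)/j(\gamma,z)^k$ does not depend on $z$. For $\tau\in\mathrm{SL}_2(\mathbb Z)$ let the width $n_\tau$ be the smallest positive integer $n$ such that $\tau U^{n}\tau^{-1}$ generates, modulo $\pm I$, the stabilizer of the cusp $\tau\infty$ in $\Gamma$,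 and let the cusp parameter $\kappa_\tau\in[0,1)$ be defined by $e^{2\pi i\kappa_\tau}=\upsilon(\tau U^{n_\tau}\tau^{-1})$. The space $S(\Gamma,k,\nu)$ of cusp forms consists of the holomorphic functions $f:\mathbb H\to\mathbb C$ with $f(\gamma z)=\nu(\gamma,z)f(z)$ for all $\gamma\in\Gamma$, $z\in\mathbb H$, that have at every cusp $\tau\infty$, $\tau\in\mathrm{SL}_2(\mathbb Z)$, a Fourier expansion $$j(\tau,z)^{-k}f(\tau z)=\sum_{m\in\mathbb Z,\ m+\kappa_\tau>0}a_\tau(m)\,e^{2\pi i(m+\kappa_\tau)z/n_\tau}\qquad(z\in\mathbb H).$$ The Petersson inner product on $S(\Gamma,k,\nu)$ is $$\langle f,g\rangle_\Gamma=\frac1{[\mathrm{SL}_2(\mathbb Z):\Gamma]}\int_{\mathcal F_\Gamma}f(z)\overline{g(z)}\,y^k\,\frac{dx\,dy}{y^2},$$ where $\mathcal F_\Gamma$ is any fundamental domain for the action of $\Gamma/\{\pm I\}$ on $\mathbb H$. **Theorem.** For every compact set $K\subset\mathbb H$ there is a constant $C>0$, depending only on $K$, such that for every finite index subgroup $\Gamma\ni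 -I$ of $\mathrm{SL}_2(\mathbb Z)$, every real $k\ge 6$, every automorphy factor $\nu$ of weight $k$ on $\Gamma$ and every $f\in S(\Gamma,k,\nu)$ with $\langle f,f\rangle_\Gamma=1$, $$\sup_{z\in K}\,y^{k/2}\,|f(z)|\;\le\; C\,[\mathrm{SL}_2(\mathbb Z):\Gamma]^{1/2}\,k^{1/2}.$$ -/

import Mathlib

open UpperHalfPlane MeasureTheory Matrix.SpecialLinearGroup
open scoped MatrixGroups Manifold ComplexConjugate

namespace RealWeight

noncomputable section

/-- `ν` is an automorphy factor of real weight `k` on the subgroup `Γ` of `SL(2, ℤ)`. Here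
`denom γ z = c z + d`, and the last condition says `ν(-γ, z) = ν(γ, z)`. -/
structure IsAutomorphyFactor (Γ : Subgroup SL(2, ℤ)) (k : ℝ) (ν : Γ → ℍ → ℂ) : Prop where
  holo : ∀ γ : Γ, MDifferentiable 𝓘(ℂ) 𝓘(ℂ) (ν γ)
  norm_eq : ∀ (γ : Γ) (z : ℍ), ‖ν γ z‖ = ‖denom (γ : SL(2, ℤ)) z‖ ^ k
  mul_eq : ∀ (τ γ : Γ) (z : ℍ), ν (τ * γ) z = ν τ ((γ : SL(2, ℤ)) • z) * ν γ z
  neg_eq : ∀ γ γ' : Γ, (γ' : SL(2, ℤ)) = -(γ : SL(2, ℤ)) → ∀ z : ℍ, ν γ' z = ν γ z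

/-- The value `υ(γ) = ν(γ, z) / j(γ, z)^k` of the multiplier system attached to `ν`, with the
principal branch of the power. -/
def multiplier {Γ : Subgroup SL(2, ℤ)} (k : ℝ) (ν : Γ → ℍ → ℂ) (γ : Γ) (z : ℍ) : ℂ :=
  ν γ z / (denom (γ : SL(2, ℤ)) z) ^ (k : ℂ)

/-- The transform `(f|_k γ)(z) = j(γ, z)^(-k) f(γ z)`, with the principal branch of the power. -/
def slash (k : ℝ) (f : ℍ → ℂ) (γ : SL(2, ℤ)) (z : ℍ) : ℂ :=
  (denom γ z) ^ (-(k : ℂ)) * f (γ • z)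

/-- The stabilizer in `Γ` of the cusp `τ ∞` of the projective line over `ℚ`. -/
def cuspStabilizer (Γ : Subgroup SL(2, ℤ)) (τ : SL(2, ℤ)) : Subgroup SL(2, ℤ) :=
  Γ ⊓ (MulAction.stabilizer (GL (Fin 2) ℚ)
    (mapGL ℚ τ • (OnePoint.infty : OnePoint ℚ))).comap (mapGL ℚ)

/-- `n` is the width of the cusp `τ ∞`: the smallest positive integer such that `τ Uⁿ τ⁻¹`
generates the stabilizer of the cusp in `Γ` modulo `±1`, where `U = (1 1; 0 1)`. -/
def IsCuspWidth (Γ : Subgroup SL(2, ℤ)) (τ : SL(2, ℤ)) (n : ℕ) : Prop :=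
  IsLeast {m : ℕ | 0 < m ∧
    cuspStabilizer Γ τ = Subgroup.closure {τ * ModularGroup.T ^ m * τ⁻¹, -1}} n

/-- `κ` is the parameter of the cusp `τ ∞` of width `n`: it lies in `[0, 1)` and
`exp(2 π i κ) = υ(τ Uⁿ τ⁻¹)`. -/
def IsCuspParameter {Γ : Subgroup SL(2, ℤ)} (k : ℝ) (ν : Γ → ℍ → ℂ) (τ : SL(2, ℤ)) (n : ℕ)
    (κ : ℝ) : Prop :=
  κ ∈ Set.Ico (0 : ℝ) 1 ∧ ∃ γ : Γ, (γ : SL(2, ℤ)) = τ * ModularGroup.T ^ n * τ⁻¹ ∧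
    ∀ z : ℍ, Complex.exp (2 * Real.pi * Complex.I * κ) = multiplier k ν γ z

/-- `f` is a cusp form of weight `k` and automorphy factor `ν` on `Γ`, that is
`f ∈ S(Γ, k, ν)`. At every cusp, the Fourier expansion has only terms with `m + κ > 0`. -/
structure IsCuspForm {Γ : Subgroup SL(2, ℤ)} (k : ℝ) (ν : Γ → ℍ → ℂ) (f : ℍ → ℂ) : Prop where
  holo : MDifferentiable 𝓘(ℂ) 𝓘(ℂ) f
  transform : ∀ (γ : Γ) (z : ℍ), f ((γ : SL(2, ℤ)) • z) = ν γ z * f z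
  expansion : ∀ τ : SL(2, ℤ), ∃ (n : ℕ) (κ : ℝ) (a : ℤ → ℂ),
    IsCuspWidth Γ τ n ∧ IsCuspParameter k ν τ n κ ∧ (∀ m : ℤ, (m : ℝ) + κ ≤ 0 → a m = 0) ∧
    ∀ z : ℍ, HasSum (fun m : ℤ => a m *
      Complex.exp (2 * Real.pi * Complex.I * ((m : ℂ) + κ) * (z : ℂ) / n)) (slash k f τ z)

/-- `F` is a fundamental domain for `Γ` acting on `ℍ`, with respect to the hyperbolic measure
`dx dy / y²`. Since `-1` acts trivially, the group used is the image of `Γ` in the group of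
permutations of `ℍ`, which is `Γ` modulo `±1`. -/
def IsFundDomain (Γ : Subgroup SL(2, ℤ)) (F : Set ℍ) : Prop :=
  IsFundamentalDomain (Γ.map (MulAction.toPermHom SL(2, ℤ) ℍ)) F (volume : Measure ℍ)

/-- The Petersson inner product of weight `k`, normalised by the index of `Γ` in `SL(2, ℤ)` and
computed on the fundamental domain `F`; `volume` on `ℍ` is `dx dy / y²`. -/
def petersson (Γ : Subgroup SL(2, ℤ)) (k : ℝ) (F : Set ℍ) (f g : ℍ → ℂ) : ℂ :=
  (1 / (Γ.index : ℂ)) * ∫ z in F, f z * conj (g z) * ((z.im ^ k : ℝ) : ℂ)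

end

end RealWeight

/-!
The bound is local. For a holomorphic function `f` on `ℍ`, the value of `‖f z‖ ^ 2 (im z) ^ k` at `z₀`
is at most `6 k` times its integral over the hyperbolic ball of radius `1` around `z₀`
(`im_rpow_mul_normSq_le_lintegral`). This is the mean value inequality on a Euclidean disc of radius
comparable to `im z₀ / √k`, whose area is of order `(im z₀) ^ 2 / k`; the factor `(im z) ^ k`, which
is not constant on such a disc, is replaced by the absolute value of a holomorphic exponential with
the same logarithmic derivative at `z₀`.

For a cusp form the density `‖f z‖ ^ 2 (im z) ^ k` is `Γ`-invariant, so its integral over the closed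
`1`-thickening `B` of `K`, which is compact, is at most `N` times its integral over a fundamental
domain, where `N` counts the transformations from the full modular group that move `B` to a set
meeting `B`; it is finite by proper discontinuity and does not depend on `Γ`
(`RealWeight.setLIntegral_le_of_isFundDomain`). For `f` of norm `1` the integral over the fundamental
domain is the index of `Γ`, and `√(6 N + 1)` serves as the constant. The density is
integrable over the fundamental domain because its integral there is not `0`.
-/

open scoped ENNReal

/-! ### The local estimate for holomorphic functions -/

/-- The area mean value inequality for holomorphic functions: the mean value property on circles,
integrated over the radius in polar coordinates. -/
theorem lintegral_ball_enorm_ge {g : ℂ → ℂ} {c : ℂ} {r : ℝ} (hr : 0 ≤ r)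
    (hg : DifferentiableOn ℂ g (Metric.ball c r)) :
    ENNReal.ofReal (Real.pi * r ^ 2) * ‖g c‖ₑ ≤ ∫⁻ w in Metric.ball c r, ‖g w‖ₑ := by
  set F : ℂ → ℝ≥0∞ := (Metric.ball c r).indicator fun w => ‖g w‖ₑ with hF
  have hFm : Measurable F := by
    classical
    rw [hF, ← Set.piecewise_eq_indicator]
    exact ContinuousOn.measurable_piecewise hg.continuousOn.enorm continuousOn_const
      Metric.isOpen_ball.measurableSet
  have hpolar (p : ℝ × ℝ) : c + Complex.polarCoord.symm p = circleMap c p.1 p.2 := by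
    rw [Complex.polarCoord_symm_apply, circleMap, Complex.exp_mul_I]
    push_cast
    rfl
  have hcm : Measurable fun p : ℝ × ℝ => circleMap c p.1 p.2 := by
    unfold circleMap
    fun_prop
  -- the mean value property on each circle inside the disc
  have hcircle (ρ : ℝ) (hρ : ρ ∈ Set.Ioo 0 r) :
      ENNReal.ofReal (2 * Real.pi) * ‖g c‖ₑ ≤
        ∫⁻ θ in Set.Ioo (-Real.pi) Real.pi, F (circleMap c ρ θ) := by
    have hsub : Metric.closedBall c |ρ| ⊆ Metric.ball c r :=
      Metric.closedBall_subset_ball (by rw [abs_of_pos hρ.1]; exact hρ.2)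
    have hmean := ((hg.mono hsub).diffContOnCl_ball subset_rfl).circleAverage
    have hper : (∫ θ in (0 : ℝ)..2 * Real.pi, g (circleMap c ρ θ)) =
        ∫ θ in Set.Ioo (-Real.pi) Real.pi, g (circleMap c ρ θ) := by
      have hp : Function.Periodic (fun θ => g (circleMap c ρ θ)) (2 * Real.pi) :=
        fun θ => by simp only [periodic_circleMap c ρ θ]
      have := hp.intervalIntegral_add_eq 0 (-Real.pi)
      rw [zero_add, show -Real.pi + 2 * Real.pi = Real.pi by ring] at this
      rw [this, intervalIntegral.integral_of_le (by linarith [Real.pi_pos]),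
        integral_Ioc_eq_integral_Ioo]
    rw [Real.circleAverage_def, hper, inv_smul_eq_iff₀ (by positivity)] at hmean
    calc ENNReal.ofReal (2 * Real.pi) * ‖g c‖ₑ
        = ‖(2 * Real.pi) • g c‖ₑ := by
          rw [enorm_smul, Real.enorm_of_nonneg (by positivity)]
      _ ≤ ∫⁻ θ in Set.Ioo (-Real.pi) Real.pi, ‖g (circleMap c ρ θ)‖ₑ := by
          rw [← hmean]; exact enorm_integral_le_lintegral_enorm _
      _ = ∫⁻ θ in Set.Ioo (-Real.pi) Real.pi, F (circleMap c ρ θ) := by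
          refine lintegral_congr fun θ => ?_
          rw [hF, Set.indicator_of_mem (hsub ?_)]
          exact Metric.sphere_subset_closedBall (circleMap_mem_sphere' c ρ θ)
  have hrad : ∫⁻ ρ in Set.Ioo 0 r, ENNReal.ofReal ρ = ENNReal.ofReal (r ^ 2 / 2) := by
    rw [← ofReal_integral_eq_lintegral_ofReal, ← integral_Ioc_eq_integral_Ioo,
      ← intervalIntegral.integral_of_le hr, integral_id]
    · simp
    · exact (continuous_id.integrableOn_Icc (a := (0 : ℝ)) (b := r)).mono_set Set.Ioo_subset_Icc_self
    · exact (ae_restrict_iff' measurableSet_Ioo).2 (.of_forall fun ρ hρ => hρ.1.le)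
  calc ENNReal.ofReal (Real.pi * r ^ 2) * ‖g c‖ₑ
      = ∫⁻ ρ in Set.Ioo 0 r, ENNReal.ofReal ρ * (ENNReal.ofReal (2 * Real.pi) * ‖g c‖ₑ) := by
        rw [lintegral_mul_const _ (by fun_prop), hrad, ← mul_assoc,
          ← ENNReal.ofReal_mul (by positivity)]
        congr 2
        ring
    _ ≤ ∫⁻ ρ in Set.Ioo 0 r, ENNReal.ofReal ρ *
          ∫⁻ θ in Set.Ioo (-Real.pi) Real.pi, F (circleMap c ρ θ) :=
        setLIntegral_mono' measurableSet_Ioo fun ρ hρ => by gcongr; exact hcircle ρ hρ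
    _ ≤ ∫⁻ ρ in Set.Ioi 0, ENNReal.ofReal ρ *
          ∫⁻ θ in Set.Ioo (-Real.pi) Real.pi, F (circleMap c ρ θ) :=
        lintegral_mono_set Set.Ioo_subset_Ioi_self
    _ = ∫⁻ p in polarCoord.target, ENNReal.ofReal p.1 • F (c + Complex.polarCoord.symm p) := by
        simp_rw [hpolar]
        rw [polarCoord_target, Measure.volume_eq_prod, ← Measure.prod_restrict, lintegral_prod]
        · refine lintegral_congr fun ρ => ?_
          simp_rw [smul_eq_mul]
          rw [lintegral_const_mul]
          exact hFm.comp (hcm.comp measurable_prodMk_left)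
        · exact ((ENNReal.measurable_ofReal.comp measurable_fst).smul (hFm.comp hcm)).aemeasurable
    _ = ∫⁻ w, F (c + w) := Complex.lintegral_comp_polarCoord_symm fun w => F (c + w)
    _ = ∫⁻ w, F w := lintegral_add_left_eq_self F c
    _ = ∫⁻ w in Metric.ball c r, ‖g w‖ₑ := lintegral_indicator Metric.isOpen_ball.measurableSet _

/-- Change of variables between Lebesgue measure on `ℂ` and the invariant measure on `ℍ`. -/
theorem setLIntegral_image_coe_eq {S : Set ℍ} (hS : MeasurableSet S) {φ : ℍ → ℝ≥0∞}
    (hφ : Measurable φ) :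
    ∫⁻ w in UpperHalfPlane.coe '' S, φ (ofComplex w) =
      ∫⁻ z in S, φ z * ENNReal.ofReal (z.im ^ 2) := by
  have hmp : MeasurePreserving UpperHalfPlane.coe
      ((volume : Measure ℂ).comap UpperHalfPlane.coe)
      (volume.restrict (.range UpperHalfPlane.coe)) :=
    ⟨measurable_coe, by rw [measurableEmbedding_coe.map_comap]⟩
  have him : Measurable fun z : ℍ => ENNReal.ofReal (z.im ^ 2) :=
    (ENNReal.continuous_ofReal.comp (continuous_im.pow 2)).measurable
  have hmk : Continuous fun z : ℍ => NNReal.mk z.im z.im_pos.le := continuous_im.subtype_mk _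
  have hden : Measurable fun z : ℍ => (((1 / NNReal.mk z.im z.im_pos.le) ^ 2 : NNReal) : ℝ≥0∞) :=
    ((continuous_const.div₀ hmk fun z => NNReal.ne_iff.mp z.im_ne_zero).pow 2).measurable
      |>.coe_nnreal_ennreal
  have hvol := setLIntegral_withDensity_eq_setLIntegral_mul
    ((volume : Measure ℂ).comap UpperHalfPlane.coe) hden (hφ.mul him) hS
  simp only [Pi.mul_apply] at hvol
  rw [volume_def, hvol,
    ← Set.inter_eq_self_of_subset_left (Set.image_subset_range _ S),
    ← Measure.restrict_restrict (measurableEmbedding_coe.measurableSet_image.2 hS),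
    ← hmp.setLIntegral_comp_emb measurableEmbedding_coe]
  refine lintegral_congr fun z => ?_
  have h1 : (((1 / NNReal.mk z.im z.im_pos.le) ^ 2 : NNReal) : ℝ≥0∞) *
      ENNReal.ofReal (z.im ^ 2) = 1 := by
    rw [ENNReal.ofReal, ← ENNReal.coe_mul, ENNReal.coe_eq_one]
    ext
    have := z.im_ne_zero
    simp [field, Real.coe_toNNReal _ (sq_nonneg z.im)]
  rw [ofComplex_apply]
  rw [mul_left_comm, h1, mul_one]

/-- The comparison of `y ^ k` with an exponential at the scale `k ^ (-1/2)`: it rests on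
`log (1 + t) ≥ t - 2 t ^ 2` and on `1 / 2 ≤ log 2`. -/
theorem exp_mul_le_two_mul_one_add_rpow {k t : ℝ} (hk : 0 < k) (ht : -(1 / 2) ≤ t)
    (hkt : 4 * k * t ^ 2 ≤ 1) : Real.exp (k * t) ≤ 2 * (1 + t) ^ k := by
  have h1 : 0 < 1 + t := by linarith
  have hlog : t - 2 * t ^ 2 ≤ Real.log (1 + t) := by
    refine le_trans ?_ (Real.one_sub_inv_le_log_of_pos h1)
    rw [← sub_nonneg]
    have : 1 - (1 + t)⁻¹ - (t - 2 * t ^ 2) = t ^ 2 * (1 + 2 * t) / (1 + t) := by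
      field_simp
      ring
    rw [this]
    exact div_nonneg (mul_nonneg (sq_nonneg t) (by linarith)) h1.le
  have h2 : k * t ≤ Real.log 2 + Real.log (1 + t) * k := by
    nlinarith [Real.log_two_gt_d9, mul_le_mul_of_nonneg_left hlog hk.le]
  calc Real.exp (k * t) ≤ Real.exp (Real.log 2 + Real.log (1 + t) * k) := Real.exp_le_exp.2 h2
    _ = 2 * (1 + t) ^ k := by
      rw [Real.exp_add, Real.exp_log two_pos, Real.rpow_def_of_pos h1]

/-- A holomorphic function on `ℍ` is bounded at `z₀` by its weighted `L²` norm on the hyperbolic ball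
of radius `1`, with a constant linear in the weight `k` and independent of `z₀`. The area mean value
inequality is applied to `g w = f w ^ 2 * exp (-I k (w - z₀) / y)` with `y = im z₀`, on the Euclidean
disc of radius `y / (2 √k)` around `z₀`: there `y ^ k * ‖g w‖` is at most `2 ‖f w‖ ^ 2 (im w) ^ k`. -/
theorem im_rpow_mul_normSq_le_lintegral {k : ℝ} (hk : 1 ≤ k) {f : ℍ → ℂ}
    (hf : MDifferentiable 𝓘(ℂ) 𝓘(ℂ) f) (z₀ : ℍ) :
    ENNReal.ofReal (z₀.im ^ k * ‖f z₀‖ ^ 2) ≤ ENNReal.ofReal (6 * k) *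
      ∫⁻ z in Metric.closedBall z₀ 1, ENNReal.ofReal (‖f z‖ ^ 2 * z.im ^ k) := by
  have hy := z₀.im_pos
  set y := z₀.im with hy_def
  have hk0 : 0 < k := by linarith
  have hsk : 1 ≤ √k := Real.one_le_sqrt.2 hk
  set r := y / (2 * √k) with hr_def
  have hr : 0 < r := by positivity
  have hry : r ≤ y / 2 := by
    rw [hr_def]
    gcongr
    linarith
  have hr2 : 4 * k * r ^ 2 = y ^ 2 := by
    rw [hr_def, div_pow, mul_pow, Real.sq_sqrt hk0.le]
    field_simp
    norm_num
  have him {w : ℂ} (hw : w ∈ Metric.ball (z₀ : ℂ) r) : |w.im - y| < r := by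
    refine lt_of_le_of_lt ?_ (mem_ball_iff_norm.1 hw)
    simpa using! Complex.abs_im_le_norm (w - z₀)
  have hpos {w : ℂ} (hw : w ∈ Metric.ball (z₀ : ℂ) r) : y / 2 < w.im := by
    linarith [(abs_lt.1 (him hw)).1]
  set g : ℂ → ℂ := fun w => (f (ofComplex w)) ^ 2 *
    Complex.exp (-(Complex.I * k * (w - z₀) / y)) with hg_def
  have hg : DifferentiableOn ℂ g (Metric.ball (z₀ : ℂ) r) := by
    have h1 := (UpperHalfPlane.mdifferentiable_iff.1 hf).mono
      fun w (hw : w ∈ Metric.ball (z₀ : ℂ) r) => (half_pos hy).trans (hpos hw)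
    exact (h1.pow 2).mul (by fun_prop)
  set φ : ℍ → ℝ≥0∞ := fun z => ENNReal.ofReal (‖f z‖ ^ 2 * z.im ^ k) with hφ_def
  have hφ : Measurable φ := by
    refine (ENNReal.continuous_ofReal.comp ((hf.continuous.norm.pow 2).mul
      (continuous_im.rpow_const fun z => Or.inl z.im_ne_zero))).measurable
  set S : Set ℍ := UpperHalfPlane.coe ⁻¹' Metric.ball (z₀ : ℂ) r with hS_def
  have hS : MeasurableSet S := measurable_coe Metric.isOpen_ball.measurableSet
  have hSim : UpperHalfPlane.coe '' S = Metric.ball (z₀ : ℂ) r := by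
    refine Set.image_preimage_eq_of_subset fun w hw => ?_
    exact ⟨⟨w, (half_pos hy).trans (hpos hw)⟩, rfl⟩
  have hSball : S ⊆ Metric.closedBall z₀ 1 := by
    intro z hz
    have hzi : y / 2 < z.im := hpos hz
    have hzd : dist (z : ℂ) z₀ < r := hz
    refine (dist_le_dist_coe_div_sqrt z z₀).trans ?_
    have : y / 2 ≤ √(z.im * z₀.im) := Real.le_sqrt_of_sq_le (by nlinarith)
    rw [div_le_one (by linarith)]
    linarith
  -- the exponential twist makes up for the variation of `(im w) ^ k` over the disc
  have hpt {w : ℂ} (hw : w ∈ Metric.ball (z₀ : ℂ) r) :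
      ENNReal.ofReal (y ^ k) * ‖g w‖ₑ ≤ 2 * φ (ofComplex w) := by
    have hw0 : 0 < w.im := (half_pos hy).trans (hpos hw)
    set t := (w.im - y) / y with ht_def
    have hty : t * y = w.im - y := by rw [ht_def]; field_simp
    have h1t : y * (1 + t) = w.im := by linarith
    have ht : -(1 / 2) ≤ t := by nlinarith [hpos hw]
    have ht2 : 4 * k * t ^ 2 ≤ 1 := by
      have : (w.im - y) ^ 2 ≤ r ^ 2 := sq_le_sq.2 (by rw [abs_of_pos hr]; exact (him hw).le)
      have h4 : 4 * k * (w.im - y) ^ 2 ≤ y ^ 2 := by rw [← hr2]; gcongr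
      rw [ht_def, div_pow, ← mul_div_assoc, div_le_one (by positivity)]
      exact h4
    have hre : (-(Complex.I * k * (w - z₀) / y)).re = k * t := by
      rw [Complex.neg_re, Complex.div_ofReal_re]
      simp [ht_def, hy_def]
      ring
    have hng : ‖g w‖ = ‖f (ofComplex w)‖ ^ 2 * Real.exp (k * t) := by
      rw [hg_def, norm_mul, norm_pow, Complex.norm_exp, hre]
    have hyk : y ^ k * Real.exp (k * t) ≤ 2 * w.im ^ k := by
      rw [← h1t, Real.mul_rpow hy.le (by linarith)]
      calc y ^ k * Real.exp (k * t) ≤ y ^ k * (2 * (1 + t) ^ k) := by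
            gcongr
            exact exp_mul_le_two_mul_one_add_rpow hk0 ht ht2
        _ = _ := by ring
    have hoc : (ofComplex w).im = w.im := by rw [ofComplex_apply_of_im_pos hw0]; rfl
    rw [← ofReal_norm, ← ENNReal.ofReal_mul (by positivity), hng, hφ_def,
      ← ENNReal.ofReal_ofNat, ← ENNReal.ofReal_mul (by norm_num)]
    simp only [hoc]
    refine ENNReal.ofReal_le_ofReal ?_
    calc y ^ k * (‖f (ofComplex w)‖ ^ 2 * Real.exp (k * t))
        = ‖f (ofComplex w)‖ ^ 2 * (y ^ k * Real.exp (k * t)) := by ring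
      _ ≤ ‖f (ofComplex w)‖ ^ 2 * (2 * w.im ^ k) := by gcongr
      _ = _ := by ring
  have hgz : ‖g z₀‖ₑ = ENNReal.ofReal (‖f z₀‖ ^ 2) := by
    rw [← ofReal_norm, hg_def]
    simp
  have key : ENNReal.ofReal (Real.pi * r ^ 2 * (y ^ k * ‖f z₀‖ ^ 2)) ≤
      ENNReal.ofReal (9 / 2 * y ^ 2) * ∫⁻ z in Metric.closedBall z₀ 1, φ z := by
    calc ENNReal.ofReal (Real.pi * r ^ 2 * (y ^ k * ‖f z₀‖ ^ 2))
        = ENNReal.ofReal (y ^ k) * (ENNReal.ofReal (Real.pi * r ^ 2) * ‖g z₀‖ₑ) := by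
          rw [hgz, ← ENNReal.ofReal_mul (by positivity), ← ENNReal.ofReal_mul (by positivity)]
          congr 1
          ring
      _ ≤ ENNReal.ofReal (y ^ k) * ∫⁻ w in Metric.ball (z₀ : ℂ) r, ‖g w‖ₑ := by
          gcongr
          exact lintegral_ball_enorm_ge hr.le hg
      _ = ∫⁻ w in Metric.ball (z₀ : ℂ) r, ENNReal.ofReal (y ^ k) * ‖g w‖ₑ :=
          (lintegral_const_mul' _ _ ENNReal.ofReal_ne_top).symm
      _ ≤ ∫⁻ w in Metric.ball (z₀ : ℂ) r, 2 * φ (ofComplex w) :=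
          setLIntegral_mono' Metric.isOpen_ball.measurableSet fun w hw => hpt hw
      _ = 2 * ∫⁻ z in S, φ z * ENNReal.ofReal (z.im ^ 2) := by
          rw [lintegral_const_mul' _ _ (by simp), ← hSim, setLIntegral_image_coe_eq hS hφ]
      _ ≤ 2 * ∫⁻ z in S, φ z * ENNReal.ofReal (9 / 4 * y ^ 2) := by
          gcongr 2 * ?_
          refine setLIntegral_mono' hS fun z hz => ?_
          gcongr
          have h1 : |z.im - y| < r := him hz
          nlinarith [(abs_lt.1 h1).2, z.im_pos]
      _ = ENNReal.ofReal (9 / 2 * y ^ 2) * ∫⁻ z in S, φ z := by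
          rw [lintegral_mul_const _ hφ, mul_comm (∫⁻ z in S, φ z), ← mul_assoc,
            ← ENNReal.ofReal_ofNat, ← ENNReal.ofReal_mul (by norm_num)]
          congr 2
          ring
      _ ≤ _ := by
          exact mul_le_mul' le_rfl (lintegral_mono_set hSball)
  calc ENNReal.ofReal (y ^ k * ‖f z₀‖ ^ 2)
      = ENNReal.ofReal (4 * k / (Real.pi * y ^ 2)) *
          ENNReal.ofReal (Real.pi * r ^ 2 * (y ^ k * ‖f z₀‖ ^ 2)) := by
        rw [← ENNReal.ofReal_mul (by positivity)]
        congr 1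
        have : 4 * k / (Real.pi * y ^ 2) * (Real.pi * r ^ 2 * (y ^ k * ‖f z₀‖ ^ 2)) =
          (4 * k * r ^ 2) / y ^ 2 * (y ^ k * ‖f z₀‖ ^ 2) := by
          field_simp
        rw [this, hr2, div_self (by positivity), one_mul]
    _ ≤ ENNReal.ofReal (4 * k / (Real.pi * y ^ 2)) *
          (ENNReal.ofReal (9 / 2 * y ^ 2) * ∫⁻ z in Metric.closedBall z₀ 1, φ z) := by
        gcongr
    _ ≤ _ := by
        rw [← mul_assoc, ← ENNReal.ofReal_mul (by positivity)]
        refine mul_le_mul' (ENNReal.ofReal_le_ofReal ?_) le_rfl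
        have : 4 * k / (Real.pi * y ^ 2) * (9 / 2 * y ^ 2) = 18 * k / Real.pi := by
          field_simp
          norm_num
        rw [this, div_le_iff₀ Real.pi_pos]
        nlinarith [Real.pi_gt_three]

/-! ### Unfolding over a fundamental domain -/

/-- If at most `N` elements of `G` move the set `B` to a set meeting `B`, then every orbit meets `B`
in at most `N` points counted by group elements, which bounds the integral of an invariant function
over `B` after unfolding over a fundamental domain. -/
theorem MeasureTheory.IsFundamentalDomain.setLIntegral_le_mul {G α : Type*} [Group G]
    [MulAction G α] [Countable G] [MeasurableSpace α] [MeasurableConstSMul G α] {μ : Measure α}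
    [SMulInvariantMeasure G α μ] {F B : Set α} (hF : IsFundamentalDomain G F μ)
    (hB : MeasurableSet B) {φ : α → ℝ≥0∞} (hφ : Measurable φ)
    (hinv : ∀ (g : G) x, φ (g • x) = φ x) {N : ℕ}
    (hN : {g : G | ∃ x ∈ B, g • x ∈ B}.encard ≤ N) :
    ∫⁻ x in B, φ x ∂μ ≤ N * ∫⁻ x in F, φ x ∂μ := by
  have hcount (x : α) : ∑' g : G, B.indicator φ (g • x) ≤ N * φ x := by
    have hset : {g : G | g • x ∈ B}.encard ≤ N := by
      rcases Set.eq_empty_or_nonempty {g : G | g • x ∈ B} with h | ⟨g₀, hg₀⟩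
      · simp [h]
      · refine le_trans ?_ hN
        rw [← ((mul_left_injective g₀⁻¹).injOn (s := {g : G | g • x ∈ B})).encard_image]
        refine Set.encard_le_encard ?_
        rintro _ ⟨g, hg, rfl⟩
        exact ⟨g₀ • x, hg₀, by simpa [mul_smul] using hg⟩
    calc ∑' g : G, B.indicator φ (g • x)
        = ∑' g : G, {g : G | g • x ∈ B}.indicator (fun _ => 1) g * φ x := by
          refine tsum_congr fun g => ?_
          by_cases h : g • x ∈ B <;> simp [h, hinv]
      _ = {g : G | g • x ∈ B}.encard * φ x := by
          rw [ENNReal.tsum_mul_right, ← tsum_subtype, ENNReal.tsum_set_one]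
      _ ≤ N * φ x := by
          gcongr
          exact_mod_cast hset
  calc ∫⁻ x in B, φ x ∂μ = ∑' g : G, ∫⁻ x in F, B.indicator φ (g • x) ∂μ := by
        rw [← lintegral_indicator hB, hF.lintegral_eq_tsum'']
    _ = ∫⁻ x in F, ∑' g : G, B.indicator φ (g • x) ∂μ :=
        (lintegral_tsum fun g =>
          ((hφ.indicator hB).comp (measurable_const_smul g)).aemeasurable).symm
    _ ≤ ∫⁻ x in F, N * φ x ∂μ := lintegral_mono hcount
    _ = N * ∫⁻ x in F, φ x ∂μ := lintegral_const_mul _ hφ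

theorem finite_setOf_perm_meets {B : Set ℍ} (hB : IsCompact B) :
    {σ : Equiv.Perm ℍ | σ ∈ (MulAction.toPermHom SL(2, ℤ) ℍ).range ∧
      ∃ z ∈ B, σ z ∈ B}.Finite := by
  have h := ProperlyDiscontinuousSMul.finite_disjoint_inter_image (Γ := 𝒮ℒ) hB hB
  refine (h.image fun g : 𝒮ℒ => (MulAction.toPerm g : Equiv.Perm ℍ)).subset ?_
  rintro _ ⟨⟨γ, rfl⟩, z, hz, hγz⟩
  exact ⟨⟨mapGL ℝ γ, γ, rfl⟩, ⟨γ • z, ⟨z, hz, rfl⟩, hγz⟩, Equiv.ext fun _ => rfl⟩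

namespace RealWeight

/-- The Petersson density `‖f z‖ ^ 2 (im z) ^ k` is `Γ`-invariant. -/
theorem im_rpow_mul_normSq_smul {Γ : Subgroup SL(2, ℤ)} {k : ℝ} {ν : Γ → ℍ → ℂ}
    (hν : IsAutomorphyFactor Γ k ν) {f : ℍ → ℂ} (hf : IsCuspForm k ν f) (γ : Γ) (z : ℍ) :
    ‖f ((γ : SL(2, ℤ)) • z)‖ ^ 2 * ((γ : SL(2, ℤ)) • z).im ^ k = ‖f z‖ ^ 2 * z.im ^ k := by
  have hd : 0 < ‖denom (γ : SL(2, ℤ)) z‖ := norm_pos_iff.2 (denom_ne_zero _ z)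
  have him : ((γ : SL(2, ℤ)) • z).im = z.im / ‖denom (γ : SL(2, ℤ)) z‖ ^ 2 := by
    rw [ModularGroup.im_smul_eq_div_normSq, Complex.normSq_eq_norm_sq]
  rw [hf.transform, norm_mul, hν.norm_eq, him, Real.div_rpow z.im_pos.le (by positivity),
    ← Real.rpow_natCast ‖denom _ _‖ 2, ← Real.rpow_mul hd.le, mul_comm ((2 : ℕ) : ℝ) k,
    Real.rpow_mul hd.le, Real.rpow_natCast, mul_pow]
  have := (Real.rpow_pos_of_pos hd k).ne'
  field_simp

/-- The normalisation of `f` as a lower Lebesgue integral. The density is integrable on `F` because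
otherwise the Bochner integral in `petersson` would vanish. -/
theorem setLIntegral_eq_index {Γ : Subgroup SL(2, ℤ)} (hΓ : Γ.FiniteIndex) {k : ℝ} {F : Set ℍ}
    {f : ℍ → ℂ} (h : petersson Γ k F f f = 1) :
    ∫⁻ z in F, ENNReal.ofReal (‖f z‖ ^ 2 * z.im ^ k) = Γ.index := by
  have hi : (Γ.index : ℂ) ≠ 0 := Nat.cast_ne_zero.2 hΓ.index_ne_zero
  have hfun : (fun z : ℍ => f z * conj (f z) * ((z.im ^ k : ℝ) : ℂ)) =
      fun z => ((‖f z‖ ^ 2 * z.im ^ k : ℝ) : ℂ) := by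
    funext z
    rw [Complex.mul_conj']
    push_cast
    rfl
  rw [petersson, hfun, integral_complex_ofReal, one_div, inv_mul_eq_one₀ hi] at h
  have hreal : ∫ z in F, ‖f z‖ ^ 2 * z.im ^ k = Γ.index := by exact_mod_cast h.symm
  have hint : Integrable (fun z : ℍ => ‖f z‖ ^ 2 * z.im ^ k) (volume.restrict F) := by
    by_contra hn
    rw [integral_undef hn] at hreal
    exact hΓ.index_ne_zero (by exact_mod_cast hreal.symm)
  rw [← ofReal_integral_eq_lintegral_ofReal hint
    (.of_forall fun z => mul_nonneg (sq_nonneg _) (Real.rpow_nonneg z.im_pos.le _)), hreal,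
    ENNReal.ofReal_natCast]

/-- Over a compact set, the integral of a `Γ`-invariant function is bounded by its integral over a
fundamental domain times a constant that does not depend on `Γ`: the multiplicity of the covering is
at most the number of transformations from the whole modular group that move `B` to a set meeting
`B`. -/
theorem setLIntegral_le_of_isFundDomain {B : Set ℍ} (hB : IsCompact B) :
    ∃ N : ℕ, ∀ (Γ : Subgroup SL(2, ℤ)) (F : Set ℍ), IsFundDomain Γ F →
      ∀ φ : ℍ → ℝ≥0∞, Measurable φ → (∀ γ ∈ Γ, ∀ z, φ (γ • z) = φ z) →
        ∫⁻ z in B, φ z ≤ N * ∫⁻ z in F, φ z := by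
  have hfin := finite_setOf_perm_meets hB
  refine ⟨hfin.toFinset.card, fun Γ F hF φ hφ hinv => ?_⟩
  have hpres (γ : SL(2, ℤ)) : MeasurePreserving (γ • · : ℍ → ℍ) :=
    measurePreserving_smul (mapGL ℝ γ) (volume : Measure ℍ)
  have hcount : Countable SL(2, ℤ) :=
    Function.Injective.countable (f := fun (γ : SL(2, ℤ)) i j => γ i j) fun _ _ h =>
      Matrix.SpecialLinearGroup.ext _ _ fun i j => congrFun (congrFun h i) j
  set G := Γ.map (MulAction.toPermHom SL(2, ℤ) ℍ)
  have hG : ∀ g : G, ∃ γ ∈ Γ, ∀ z : ℍ, g • z = γ • z := by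
    rintro ⟨_, γ, hγ, rfl⟩
    exact ⟨γ, hγ, fun z => rfl⟩
  have : Countable G := (Γ : Set SL(2, ℤ)).to_countable.image _
  have hmp (g : G) : MeasurePreserving (g • · : ℍ → ℍ) := by
    obtain ⟨γ, -, h⟩ := hG g
    simpa only [h] using hpres γ
  have : MeasurableConstSMul G ℍ := ⟨fun g => (hmp g).measurable⟩
  have : SMulInvariantMeasure G ℍ volume :=
    ⟨fun g s hs => (hmp g).measure_preimage hs.nullMeasurableSet⟩
  refine IsFundamentalDomain.setLIntegral_le_mul (G := G) hF hB.measurableSet hφ ?_ ?_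
  · intro g z
    obtain ⟨γ, hγ, h⟩ := hG g
    rw [h, hinv γ hγ]
  · rw [← (Subtype.val_injective.injOn (s := {g : G | ∃ x ∈ B, g • x ∈ B})).encard_image,
      ← Set.encard_coe_eq_coe_finsetCard, hfin.coe_toFinset]
    refine Set.encard_le_encard ?_
    rintro _ ⟨⟨_, γ, hγ, rfl⟩, h, rfl⟩
    exact ⟨⟨γ, rfl⟩, h⟩

end RealWeight

theorem theorem1 (K : Set UpperHalfPlane) (hK : IsCompact K) :
    ∃ C : ℝ, 0 < C ∧
      ∀ (Γ : Subgroup SL(2, ℤ)), Γ.FiniteIndex → (-1 : SL(2, ℤ)) ∈ Γ →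
      ∀ (k : ℝ), 6 ≤ k →
      ∀ (ν : Γ → ℍ → ℂ), RealWeight.IsAutomorphyFactor Γ k ν →
      ∀ (f : ℍ → ℂ), RealWeight.IsCuspForm k ν f →
      ∀ (F : Set ℍ), RealWeight.IsFundDomain Γ F → RealWeight.petersson Γ k F f f = 1 →
      ∀ z ∈ K, z.im ^ (k / 2) * ‖f z‖ ≤ C * (Γ.index : ℝ) ^ (1 / 2 : ℝ) * k ^ (1 / 2 : ℝ) := by
  obtain ⟨N, hN⟩ := RealWeight.setLIntegral_le_of_isFundDomain (hK.cthickening (r := 1))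
  -- `N` vanishes when `K` is empty, hence the summand `1`
  refine ⟨√(6 * N + 1), by positivity, fun Γ hΓ _ k hk ν hν f hf F hF hnorm z hz => ?_⟩
  have hk0 : 0 < k := by linarith
  have hφ : Measurable fun w : ℍ => ENNReal.ofReal (‖f w‖ ^ 2 * w.im ^ k) :=
    (ENNReal.continuous_ofReal.comp ((hf.holo.continuous.norm.pow 2).mul
      (continuous_im.rpow_const fun w => Or.inl w.im_ne_zero))).measurable
  have hsq : z.im ^ k * ‖f z‖ ^ 2 ≤ 6 * k * (N * Γ.index) := by
    rw [← ENNReal.ofReal_le_ofReal_iff (by positivity)]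
    calc ENNReal.ofReal (z.im ^ k * ‖f z‖ ^ 2)
        ≤ ENNReal.ofReal (6 * k) *
          ∫⁻ w in Metric.closedBall z 1, ENNReal.ofReal (‖f w‖ ^ 2 * w.im ^ k) :=
          im_rpow_mul_normSq_le_lintegral (by linarith) hf.holo z
      _ ≤ ENNReal.ofReal (6 * k) *
          ∫⁻ w in Metric.cthickening 1 K, ENNReal.ofReal (‖f w‖ ^ 2 * w.im ^ k) := by
          exact mul_le_mul' le_rfl
            (lintegral_mono_set (Metric.closedBall_subset_cthickening hz 1))
      _ ≤ ENNReal.ofReal (6 * k) *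
          (N * ∫⁻ w in F, ENNReal.ofReal (‖f w‖ ^ 2 * w.im ^ k)) := by
          gcongr
          exact hN Γ F hF _ hφ fun γ hγ w =>
            congrArg ENNReal.ofReal (RealWeight.im_rpow_mul_normSq_smul hν hf ⟨γ, hγ⟩ w)
      _ = ENNReal.ofReal (6 * k * (N * Γ.index)) := by
          rw [RealWeight.setLIntegral_eq_index hΓ hnorm, ENNReal.ofReal_mul (p := 6 * k) (by positivity),
            ENNReal.ofReal_mul (p := N) (by positivity), ENNReal.ofReal_natCast, ENNReal.ofReal_natCast]
  rw [← Real.sqrt_eq_rpow, ← Real.sqrt_eq_rpow, ← Real.sqrt_mul (by positivity),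
    ← Real.sqrt_mul (by positivity)]
  refine Real.le_sqrt_of_sq_le ?_
  have hpow : (z.im ^ (k / 2)) ^ 2 = z.im ^ k := by
    rw [← Real.rpow_natCast, ← Real.rpow_mul z.im_pos.le]
    norm_num
  rw [mul_pow, hpow]
  refine hsq.trans ?_
  have : 0 ≤ (Γ.index : ℝ) * k := by positivity
  linarith
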